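/- Let $\mathcal X=\{x_i\}_{i=1}^N$ be a data set in $\mathbb R^D$ that is not covered by two hyperplanes, i.e. $(\mathcal X\cap L_1)\cup(\mathcal X\cap L_2)\neq\mathcal X$ for all $(D-1)$-dimensional linear subspaces $L_1,L_2\subset\mathbb R^D$. Let $\mathbb H=\{Q\in\mathbb R^{D\times D}: Q=Q^T,\ \operatorname{tr}Q=1\}$ and $F(Q)=\sum_{i=1}^N\|Qx_i\|$. For $Q\in\mathbb H$ put $$I(Q)=\{i: Qx_i=0\},\qquad L(Q)=\operatorname{span}\{x_i: i\in I(Q)\},\qquad A(Q)=\sum_{i\notin I(Q)}\frac{x_ix_i^T}{\|Qx_i\|}.$$ Let $P$ be the orthogonal projection onto $L(Q)^\perp$, and let $B(Q)$ be the symmetric matrix that vanishes on $L(Q)$ and is, on $L(Q)^\perp$, the inverse of the compression of $A(Q)$ to $L(Q)^\perp$; that is, $B(Q)=P\,\bigl(PA(Q)P+(I-P)\bigr)^{-1}P$. Define $T(Q)=B(Q)/\operatorname{tr}B(Q)$. (If $Qx_i\ne0$ for all $i$, then $T(Q)=A(Q)^{-1}/\operatorname{tr}(A(Q)^{-1})$.)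 Let $Q_0\in\mathbb H$ be arbitrary and let $Q_{k+1}=T(Q_k)$ for $k\ge 0$. Then $F$ has a unique minimizer $\hat Q$ on $\mathbb H$, and $(Q_k)$ converges to a matrix $\tilde Q\in\mathbb H$. If moreover $\tilde Qx_i\neq0$ for all $1\le i\le N$, then the convergence is linear, i.e. $\|Q_k-\tilde Q\|_F\le C r^k$ for all $k\ge0$, for some $C>0$ and $r\in(0,1)$, and $\tilde Q=\hat Q$. -/

import Mathlib

open scoped Topology

noncomputable section

/-- The set of real symmetric `D × D` matrices with unit trace. -/
def traceOneSymm (D : ℕ) : Set (Matrix (Fin D) (Fin D) ℝ) :=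
  {Q | Q.IsSymm ∧ Q.trace = 1}

/-- The matrix `Q` applied to a vector of Euclidean space. -/
def matApply {D : ℕ} (Q : Matrix (Fin D) (Fin D) ℝ) (v : EuclideanSpace ℝ (Fin D)) :
    EuclideanSpace ℝ (Fin D) :=
  Matrix.toEuclideanLin Q v

/-- The objective `F(Q) = ∑ i, ‖Q x_i‖` (Euclidean norms). -/
def objective {D N : ℕ} (x : Fin N → EuclideanSpace ℝ (Fin D))
    (Q : Matrix (Fin D) (Fin D) ℝ) : ℝ :=
  ∑ i, ‖matApply Q (x i)‖

/-- `Q` minimizes `F` over the symmetric matrices of unit trace. -/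
def IsObjectiveMinimizer {D N : ℕ} (x : Fin N → EuclideanSpace ℝ (Fin D))
    (Q : Matrix (Fin D) (Fin D) ℝ) : Prop :=
  Q ∈ traceOneSymm D ∧ IsMinOn (objective x) (traceOneSymm D) Q

/-- The two-subspaces condition: the data set is not covered by two subspaces of
dimension `D - 1`. -/
def TwoSubspacesCondition {D N : ℕ} (x : Fin N → EuclideanSpace ℝ (Fin D)) : Prop :=
  ∀ L₁ L₂ : Submodule ℝ (EuclideanSpace ℝ (Fin D)),
    Module.finrank ℝ L₁ + 1 = D → Module.finrank ℝ L₂ + 1 = D →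
      (Set.range x ∩ (L₁ : Set (EuclideanSpace ℝ (Fin D)))) ∪
        (Set.range x ∩ (L₂ : Set (EuclideanSpace ℝ (Fin D)))) ≠ Set.range x

/-- `L(Q)`, the span of the data points annihilated by `Q`. -/
def annihilatedSpan {D N : ℕ} (x : Fin N → EuclideanSpace ℝ (Fin D))
    (Q : Matrix (Fin D) (Fin D) ℝ) : Submodule ℝ (EuclideanSpace ℝ (Fin D)) :=
  Submodule.span ℝ (x '' {i | matApply Q (x i) = 0})

/-- The matrix of the orthogonal projection onto `L`. -/
def projMatrix {D : ℕ} (L : Submodule ℝ (EuclideanSpace ℝ (Fin D))) :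
    Matrix (Fin D) (Fin D) ℝ :=
  Matrix.toEuclideanLin.symm (L.starProjection : _ →ₗ[ℝ] _)

open Classical in
/-- The weighted covariance `A(Q) = ∑ x_i x_iᵀ / ‖Q x_i‖`, summed over the `i` with
`Q x_i ≠ 0`. -/
def weightedCov {D N : ℕ} (x : Fin N → EuclideanSpace ℝ (Fin D))
    (Q : Matrix (Fin D) (Fin D) ℝ) : Matrix (Fin D) (Fin D) ℝ :=
  ∑ i with matApply Q (x i) ≠ 0,
    (1 / ‖matApply Q (x i)‖) • Matrix.vecMulVec (x i).ofLp (x i).ofLp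

/-- The inverse of the compression of `A(Q)` to the orthogonal complement of `L(Q)`, extended
by zero to `L(Q)`: with `P` the projection onto `L(Q)ᗮ`, the matrix `P A P + (1 - P)` is block
diagonal, equal to the compression of `A` on `L(Q)ᗮ` and to the identity on `L(Q)`.
If `Q x_i ≠ 0` for all `i`, this is `A(Q)⁻¹`. -/
def compressedInverse {D N : ℕ} (x : Fin N → EuclideanSpace ℝ (Fin D))
    (Q : Matrix (Fin D) (Fin D) ℝ) : Matrix (Fin D) (Fin D) ℝ :=
  projMatrix (annihilatedSpan x Q)ᗮ *
    (projMatrix (annihilatedSpan x Q)ᗮ * weightedCov x Q * projMatrix (annihilatedSpan x Q)ᗮ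
      + projMatrix (annihilatedSpan x Q))⁻¹ *
    projMatrix (annihilatedSpan x Q)ᗮ

/-- The unregularized IRLS step `T(Q)`: `compressedInverse` normalized to unit trace. -/
def irlsStep {D N : ℕ} (x : Fin N → EuclideanSpace ℝ (Fin D))
    (Q : Matrix (Fin D) (Fin D) ℝ) : Matrix (Fin D) (Fin D) ℝ :=
  (1 / (compressedInverse x Q).trace) • compressedInverse x Q

/-- If `Q` annihilates no data point, the step is the plain IRLS update `A⁻¹ / tr(A⁻¹)` with
`A = ∑ i, x_i x_iᵀ / ‖Q x_i‖`. -/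
theorem irlsStep_of_forall_ne {D N : ℕ} (x : Fin N → EuclideanSpace ℝ (Fin D))
    (Q : Matrix (Fin D) (Fin D) ℝ) (h : ∀ i, matApply Q (x i) ≠ 0) :
    irlsStep x Q =
      (1 / ((∑ i, (1 / ‖matApply Q (x i)‖) •
          Matrix.vecMulVec (x i).ofLp (x i).ofLp)⁻¹).trace) •
        (∑ i, (1 / ‖matApply Q (x i)‖) • Matrix.vecMulVec (x i).ofLp (x i).ofLp)⁻¹ := by
  have h1 : annihilatedSpan x Q = ⊥ := by simp [annihilatedSpan, h]
  have h2 : projMatrix (⊥ : Submodule ℝ (EuclideanSpace ℝ (Fin D))) = 0 := by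
    simp [projMatrix]
  have h3 : projMatrix (⊤ : Submodule ℝ (EuclideanSpace ℝ (Fin D))) = 1 := by
    unfold projMatrix
    rw [LinearEquiv.symm_apply_eq]
    ext v i
    simp [Submodule.starProjection_eq_self_iff.mpr (Submodule.mem_top (x := v))]
  simp [irlsStep, compressedInverse, h1, h2, h3, weightedCov, h]

/-- The Frobenius norm of a matrix. -/
def frobNorm {D : ℕ} (M : Matrix (Fin D) (Fin D) ℝ) : ℝ :=
  Real.sqrt (∑ i, ∑ j, M i j ^ 2)

/-- Linear (geometric) convergence of a sequence of matrices:
`‖Q_k - Q'‖ ≤ C r^k` for some `C > 0` and some rate `r < 1`. -/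
def ConvergesLinearly {D : ℕ} (Q : ℕ → Matrix (Fin D) (Fin D) ℝ)
    (Q' : Matrix (Fin D) (Fin D) ℝ) : Prop :=
  ∃ C r : ℝ, 0 < C ∧ 0 < r ∧ r < 1 ∧ ∀ k, frobNorm (Q k - Q') ≤ C * r ^ k

end

/-! IRLS is majorization-minimization. The step `T(Q)` minimizes the quadratic form `∑ ‖S x_i‖² / ‖Q
x_i‖` among unit-trace symmetric `S` annihilating the data points that `Q` annihilates. Only its
first-order condition is needed (`sum_inner_irlsStep_eq_zero`), together with the fact that `T(Q)`
and `Q` annihilate the same data points (`matApply_irlsStep_eq_zero_iff`).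

The two-subspaces condition enters twice. The data span the space, so `F` is coercive; and if `A
x_i` and `B x_i` are dependent for every `i`, then `A = B` (`eq_of_dependent`), so `F` is strictly
convex on unit-trace symmetric matrices. Existence and uniqueness of the minimizer follow.

Majorization bounds the weighted squared increment by twice the decrease of `F`, so the iterates are
bounded and their increments vanish. A cluster point may annihilate more data points than the
iterates do, but it is stationary in the directions that annihilate its own points. By strict
convexity there is at most one such matrix per set of annihilated points, hence there are finitely
many cluster points, and a bounded sequence with vanishing increments then converges.

If the limit annihilates no data point, every traceless symmetric direction is admissible, so
convexity makes it the global minimizer. The weights are then bounded, and `F` grows quadratically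
at the limit (`exists_quadratic_growth`). Comparing the step with the best point on the segment
towards the limit contracts the gap in `F` by a fixed factor. -/

/-! ### Matrices acting on Euclidean vectors -/

theorem matApply_add {D : ℕ} (A B : Matrix (Fin D) (Fin D) ℝ) (v : EuclideanSpace ℝ (Fin D)) :
    matApply (A + B) v = matApply A v + matApply B v := by
  simp [matApply]

theorem matApply_sub {D : ℕ} (A B : Matrix (Fin D) (Fin D) ℝ) (v : EuclideanSpace ℝ (Fin D)) :
    matApply (A - B) v = matApply A v - matApply B v := by
  simp [matApply]

theorem matApply_smul {D : ℕ} (c : ℝ) (A : Matrix (Fin D) (Fin D) ℝ)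
    (v : EuclideanSpace ℝ (Fin D)) : matApply (c • A) v = c • matApply A v := by
  simp [matApply]

theorem matApply_mul {D : ℕ} (A B : Matrix (Fin D) (Fin D) ℝ) (v : EuclideanSpace ℝ (Fin D)) :
    matApply (A * B) v = matApply A (matApply B v) := by
  ext i
  simp [matApply, Matrix.toLpLin_apply, Matrix.mulVec_mulVec]

theorem ofLp_matApply {D : ℕ} (A : Matrix (Fin D) (Fin D) ℝ) (v : EuclideanSpace ℝ (Fin D)) :
    (matApply A v).ofLp = A.mulVec v.ofLp := by
  simp [matApply, Matrix.toLpLin_apply]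

theorem matApply_ext {D : ℕ} {A B : Matrix (Fin D) (Fin D) ℝ}
    (h : ∀ v, matApply A v = matApply B v) : A = B :=
  Matrix.toEuclideanLin.injective (LinearMap.ext h)

theorem inner_matApply_left {D : ℕ} {A : Matrix (Fin D) (Fin D) ℝ} (hA : A.IsSymm)
    (u v : EuclideanSpace ℝ (Fin D)) :
    inner ℝ (matApply A u) v = inner ℝ u (matApply A v) := by
  simp only [EuclideanSpace.inner_eq_star_dotProduct, ofLp_matApply, star_trivial]
  rw [Matrix.dotProduct_mulVec, ← Matrix.mulVec_transpose, hA.eq, dotProduct_comm,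
    Matrix.dotProduct_mulVec, ← Matrix.mulVec_transpose, hA.eq, dotProduct_comm,
    Matrix.dotProduct_mulVec, ← Matrix.mulVec_transpose, hA.eq]

/-! ### Consequences of the two-subspaces condition -/

/-- A proper subspace lies in a subspace of dimension `D - 1`. -/
theorem exists_hyperplane_ge {D : ℕ} (V : Submodule ℝ (EuclideanSpace ℝ (Fin D))) (hV : V ≠ ⊤) :
    ∃ L : Submodule ℝ (EuclideanSpace ℝ (Fin D)), Module.finrank ℝ L + 1 = D ∧ V ≤ L := by
  obtain ⟨f, hf, hle⟩ := Submodule.exists_le_ker_of_lt_top V hV.lt_top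
  refine ⟨LinearMap.ker f, ?_, hle⟩
  simpa using Module.Dual.finrank_ker_add_one_of_ne_zero hf

theorem TwoSubspacesCondition.exists_notMem {D N : ℕ} {x : Fin N → EuclideanSpace ℝ (Fin D)}
    (hx : TwoSubspacesCondition x) {V W : Submodule ℝ (EuclideanSpace ℝ (Fin D))}
    (hV : V ≠ ⊤) (hW : W ≠ ⊤) : ∃ i, x i ∉ V ∧ x i ∉ W := by
  by_contra! h
  obtain ⟨L₁, h₁, hV₁⟩ := exists_hyperplane_ge V hV
  obtain ⟨L₂, h₂, hW₂⟩ := exists_hyperplane_ge W hW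
  refine hx L₁ L₂ h₁ h₂ (Set.Subset.antisymm (by simp) ?_)
  rintro _ ⟨i, rfl⟩
  by_cases hi : x i ∈ V
  · exact Or.inl ⟨⟨i, rfl⟩, hV₁ hi⟩
  · exact Or.inr ⟨⟨i, rfl⟩, hW₂ (h i hi)⟩

theorem TwoSubspacesCondition.eq_top {D N : ℕ} {x : Fin N → EuclideanSpace ℝ (Fin D)}
    (hx : TwoSubspacesCondition x) {V : Submodule ℝ (EuclideanSpace ℝ (Fin D))}
    (hV : ∀ i, x i ∈ V) : V = ⊤ := by
  by_contra h
  obtain ⟨i, hi, -⟩ := hx.exists_notMem h h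
  exact hi (hV i)

theorem TwoSubspacesCondition.eq_zero {D N : ℕ} {x : Fin N → EuclideanSpace ℝ (Fin D)}
    (hx : TwoSubspacesCondition x) {A : Matrix (Fin D) (Fin D) ℝ}
    (hA : ∀ i, matApply A (x i) = 0) : A = 0 := by
  have h := hx.eq_top (V := LinearMap.ker (Matrix.toEuclideanLin A)) hA
  exact Matrix.toEuclideanLin.map_eq_zero_iff.mp (LinearMap.ker_eq_top.mp h)

/-- Two symmetric matrices of unit trace whose values are linearly dependent at every data point
are equal. -/
theorem TwoSubspacesCondition.eq_of_dependent {D N : ℕ} {x : Fin N → EuclideanSpace ℝ (Fin D)}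
    (hx : TwoSubspacesCondition x) {A B : Matrix (Fin D) (Fin D) ℝ}
    (hA : A ∈ traceOneSymm D) (hB : B ∈ traceOneSymm D)
    (h : ∀ i, ∃ a b : ℝ, (a ≠ 0 ∨ b ≠ 0) ∧ a • matApply A (x i) = b • matApply B (x i)) :
    A = B := by
  obtain ⟨j, hj⟩ : ∃ j, matApply A (x j) ≠ 0 := by
    by_contra! h0
    have := hA.2
    simp [hx.eq_zero h0] at this
  obtain ⟨a, b, hab, hj'⟩ := h j
  -- The two subspaces are `ker (aA - bB)` and `(A x_j)ᗮ`. By symmetry, pairing `A x_i` and `B x_i`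
  -- with `x_j` gives the products of `x_i` with `A x_j` and `B x_j`. So for `x_i` outside the
  -- second subspace the dependence at `i` has the same ratio as the one at `j`, which puts `x_i` in
  -- the first. Hence the first is everything, and the traces force `a = b`.
  set V := LinearMap.ker (Matrix.toEuclideanLin (a • A - b • B)) with hVdef
  have hb : b ≠ 0 := by
    rintro rfl
    rcases hab with ha | hb
    · rw [zero_smul] at hj'
      exact hj ((smul_eq_zero.mp hj').resolve_left ha)
    · exact hb rfl
  set W := LinearMap.ker (innerₛₗ ℝ (matApply A (x j))) with hWdef
  have hW : W ≠ ⊤ := by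
    intro hW
    have : matApply A (x j) ∈ W := hW ▸ Submodule.mem_top
    simp only [hWdef, LinearMap.mem_ker, innerₛₗ_apply_apply, inner_self_eq_zero] at this
    exact hj this
  by_cases hV : V = ⊤
  · have h0 : a • A - b • B = 0 :=
      Matrix.toEuclideanLin.map_eq_zero_iff.mp (LinearMap.ker_eq_top.mp hV)
    have htr : a - b = 0 := by
      have := congrArg Matrix.trace h0
      simpa [Matrix.trace_sub, Matrix.trace_smul, hA.2, hB.2] using this
    have hab' : a = b := sub_eq_zero.mp htr
    rw [hab', ← smul_sub] at h0
    exact sub_eq_zero.mp ((smul_eq_zero.mp h0).resolve_left hb)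
  · exfalso
    obtain ⟨i, hiV, hiW⟩ := hx.exists_notMem hV hW
    obtain ⟨c, d, hcd, hi⟩ := h i
    have e1 : a * inner ℝ (matApply A (x j)) (x i) = b * inner ℝ (matApply B (x j)) (x i) := by
      rw [← real_inner_smul_left, ← real_inner_smul_left, hj']
    have e2 : c * inner ℝ (matApply A (x j)) (x i) = d * inner ℝ (matApply B (x j)) (x i) := by
      rw [inner_matApply_left hA.1, inner_matApply_left hB.1, ← real_inner_smul_right,
        ← real_inner_smul_right, hi]
    have hne : inner ℝ (matApply A (x j)) (x i) ≠ 0 := hiW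
    have hdet : a * d - b * c = 0 := by
      have : (a * d - b * c) * inner ℝ (matApply A (x j)) (x i) = 0 := by
        linear_combination d * e1 - b * e2
      exact (mul_eq_zero.mp this).resolve_right hne
    apply hiV
    change matApply (a • A - b • B) (x i) = 0
    rw [matApply_sub, matApply_smul, matApply_smul]
    have hd : d ≠ 0 := by
      rintro rfl
      rcases hcd with hc | hd
      · rw [zero_mul] at e2
        exact hne ((mul_eq_zero.mp e2).resolve_left hc)
      · exact hd rfl
    have : d • (a • matApply A (x i) - b • matApply B (x i)) = 0 := by
      have hda : d * a = b * c := by linarith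
      rw [smul_sub, smul_smul, smul_smul, hda, mul_comm d b, ← smul_smul b c, ← smul_smul b d, hi,
        sub_self]
    exact (smul_eq_zero.mp this).resolve_left hd

/-! ### The IRLS step: well-definedness, kernel and first-order condition -/

theorem isSymm_of_inner {D : ℕ} {A : Matrix (Fin D) (Fin D) ℝ}
    (h : ∀ u v, inner ℝ (matApply A u) v = inner ℝ u (matApply A v)) : A.IsSymm := by
  refine matApply_ext fun v => ext_inner_left ℝ fun u => ?_
  rw [← h]
  simp only [EuclideanSpace.inner_eq_star_dotProduct, ofLp_matApply, star_trivial]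
  rw [Matrix.mulVec_transpose, Matrix.dotProduct_mulVec]

theorem matApply_projMatrix {D : ℕ} (L : Submodule ℝ (EuclideanSpace ℝ (Fin D)))
    (v : EuclideanSpace ℝ (Fin D)) : matApply (projMatrix L) v = L.starProjection v := by
  simp [matApply, projMatrix]

theorem isSymm_projMatrix {D : ℕ} (L : Submodule ℝ (EuclideanSpace ℝ (Fin D))) :
    (projMatrix L).IsSymm :=
  isSymm_of_inner fun u v => by
    rw [matApply_projMatrix, matApply_projMatrix, Submodule.inner_starProjection_left_eq_right]

theorem matApply_one {D : ℕ} (v : EuclideanSpace ℝ (Fin D)) : matApply 1 v = v := by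
  ext i
  simp [ofLp_matApply]

theorem projMatrix_orthogonal_add {D : ℕ} (L : Submodule ℝ (EuclideanSpace ℝ (Fin D))) :
    projMatrix Lᗮ + projMatrix L = 1 := by
  refine matApply_ext fun v => ?_
  rw [matApply_add, matApply_projMatrix, matApply_projMatrix, matApply_one, add_comm,
    Submodule.starProjection_add_starProjection_orthogonal]

theorem annihilatedSpan_le_ker {D N : ℕ} (x : Fin N → EuclideanSpace ℝ (Fin D))
    {Q Z : Matrix (Fin D) (Fin D) ℝ} (hZ : ∀ i, matApply Q (x i) = 0 → matApply Z (x i) = 0) :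
    annihilatedSpan x Q ≤ LinearMap.ker (Matrix.toEuclideanLin Z) := by
  rw [annihilatedSpan, Submodule.span_le]
  rintro _ ⟨i, hi, rfl⟩
  exact hZ i hi

theorem mem_annihilatedSpan_iff {D N : ℕ} (x : Fin N → EuclideanSpace ℝ (Fin D))
    (Q : Matrix (Fin D) (Fin D) ℝ) (i : Fin N) :
    x i ∈ annihilatedSpan x Q ↔ matApply Q (x i) = 0 :=
  ⟨fun h => annihilatedSpan_le_ker x (fun _ => id) h, fun h => Submodule.subset_span ⟨i, h, rfl⟩⟩

/-- Since `1 / 0 = 0`, annihilated points carry weight zero and the filter can be dropped; all later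
weighted sums rely on this convention. -/
theorem weightedCov_eq_sum {D N : ℕ} (x : Fin N → EuclideanSpace ℝ (Fin D))
    (Q : Matrix (Fin D) (Fin D) ℝ) :
    weightedCov x Q =
      ∑ i, (1 / ‖matApply Q (x i)‖) • Matrix.vecMulVec (x i).ofLp (x i).ofLp := by
  refine Finset.sum_filter_of_ne fun i _ h hi => h ?_
  simp [hi]

theorem trace_mul_vecMulVec_mul {D : ℕ} {T : Matrix (Fin D) (Fin D) ℝ} (hT : T.IsSymm)
    (Z : Matrix (Fin D) (Fin D) ℝ) (v : EuclideanSpace ℝ (Fin D)) :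
    (Z * Matrix.vecMulVec v.ofLp v.ofLp * T).trace = inner ℝ (matApply Z v) (matApply T v) := by
  rw [Matrix.mul_vecMulVec, Matrix.vecMulVec_mul, Matrix.trace_vecMulVec,
    EuclideanSpace.inner_eq_star_dotProduct, ofLp_matApply, ofLp_matApply, star_trivial,
    ← Matrix.mulVec_transpose, hT.eq, dotProduct_comm]

theorem trace_mul_weightedCov_mul {D N : ℕ} (x : Fin N → EuclideanSpace ℝ (Fin D))
    (Q : Matrix (Fin D) (Fin D) ℝ) {T : Matrix (Fin D) (Fin D) ℝ} (hT : T.IsSymm)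
    (Z : Matrix (Fin D) (Fin D) ℝ) :
    (Z * weightedCov x Q * T).trace =
      ∑ i, 1 / ‖matApply Q (x i)‖ * inner ℝ (matApply Z (x i)) (matApply T (x i)) := by
  rw [weightedCov_eq_sum, Finset.mul_sum, Finset.sum_mul, Matrix.trace_sum]
  refine Finset.sum_congr rfl fun i _ => ?_
  rw [Matrix.mul_smul, Matrix.smul_mul, Matrix.trace_smul, trace_mul_vecMulVec_mul hT, smul_eq_mul]

theorem matApply_vecMulVec {D : ℕ} (u v : EuclideanSpace ℝ (Fin D)) :
    matApply (Matrix.vecMulVec u.ofLp u.ofLp) v = inner ℝ u v • u := by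
  ext i
  simp [ofLp_matApply, Matrix.vecMulVec_mulVec, EuclideanSpace.inner_eq_star_dotProduct,
    dotProduct_comm, mul_comm]

theorem matApply_weightedCov {D N : ℕ} (x : Fin N → EuclideanSpace ℝ (Fin D))
    (Q : Matrix (Fin D) (Fin D) ℝ) (v : EuclideanSpace ℝ (Fin D)) :
    matApply (weightedCov x Q) v = ∑ i, (1 / ‖matApply Q (x i)‖) • inner ℝ (x i) v • x i := by
  rw [weightedCov_eq_sum]
  conv_lhs => rw [matApply, map_sum, LinearMap.sum_apply]
  refine Finset.sum_congr rfl fun i _ => ?_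
  rw [← matApply_vecMulVec]
  exact matApply_smul _ _ _

theorem inner_weightedCov {D N : ℕ} (x : Fin N → EuclideanSpace ℝ (Fin D))
    (Q : Matrix (Fin D) (Fin D) ℝ) (u v : EuclideanSpace ℝ (Fin D)) :
    inner ℝ u (matApply (weightedCov x Q) v) =
      ∑ i, 1 / ‖matApply Q (x i)‖ * (inner ℝ u (x i) * inner ℝ (x i) v) := by
  rw [matApply_weightedCov, inner_sum]
  refine Finset.sum_congr rfl fun i _ => ?_
  rw [real_inner_smul_right, real_inner_smul_right, mul_comm (inner ℝ (x i) v)]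

theorem isSymm_weightedCov {D N : ℕ} (x : Fin N → EuclideanSpace ℝ (Fin D))
    (Q : Matrix (Fin D) (Fin D) ℝ) : (weightedCov x Q).IsSymm :=
  isSymm_of_inner fun u v => by
    rw [real_inner_comm, inner_weightedCov, inner_weightedCov]
    refine Finset.sum_congr rfl fun i _ => ?_
    rw [real_inner_comm (x i) u, real_inner_comm (x i) v]
    ring

/-- The block diagonal matrix `P A P + (1 - P)` whose inverse enters `compressedInverse`. -/
noncomputable def blockCov {D N : ℕ} (x : Fin N → EuclideanSpace ℝ (Fin D)) (Q : Matrix (Fin D) (Fin D) ℝ) :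
    Matrix (Fin D) (Fin D) ℝ :=
  projMatrix (annihilatedSpan x Q)ᗮ * weightedCov x Q * projMatrix (annihilatedSpan x Q)ᗮ
      + projMatrix (annihilatedSpan x Q)

theorem compressedInverse_eq {D N : ℕ} (x : Fin N → EuclideanSpace ℝ (Fin D))
    (Q : Matrix (Fin D) (Fin D) ℝ) :
    compressedInverse x Q = projMatrix (annihilatedSpan x Q)ᗮ * (blockCov x Q)⁻¹ *
      projMatrix (annihilatedSpan x Q)ᗮ := rfl

theorem posDef_of_inner_pos {D : ℕ} {A : Matrix (Fin D) (Fin D) ℝ} (hA : A.IsSymm)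
    (h : ∀ v, v ≠ 0 → 0 < inner ℝ v (matApply A v)) : A.PosDef := by
  refine Matrix.PosDef.of_dotProduct_mulVec_pos ?_ fun v hv => ?_
  · rw [Matrix.IsHermitian, Matrix.conjTranspose_eq_transpose_of_trivial]
    exact hA
  · have := h (WithLp.toLp 2 v) (by simpa using hv)
    rwa [EuclideanSpace.inner_eq_star_dotProduct, ofLp_matApply, star_trivial,
      dotProduct_comm] at this

theorem inner_blockCov {D N : ℕ} (x : Fin N → EuclideanSpace ℝ (Fin D))
    (Q : Matrix (Fin D) (Fin D) ℝ) (v : EuclideanSpace ℝ (Fin D)) :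
    inner ℝ v (matApply (blockCov x Q) v) =
      ∑ i, 1 / ‖matApply Q (x i)‖ *
          inner ℝ (x i) ((annihilatedSpan x Q)ᗮ.starProjection v) ^ 2 +
        ‖(annihilatedSpan x Q).starProjection v‖ ^ 2 := by
  rw [blockCov, matApply_add, inner_add_right, matApply_mul, matApply_mul,
    ← inner_matApply_left (isSymm_projMatrix _), inner_weightedCov, matApply_projMatrix,
    matApply_projMatrix, ← real_inner_self_eq_norm_sq,
    Submodule.inner_starProjection_left_eq_right,
    Submodule.starProjection_eq_self_iff.mpr (Submodule.starProjection_apply_mem _ v)]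
  congr 1
  refine Finset.sum_congr rfl fun i _ => ?_
  rw [real_inner_comm (x i), sq]

/-- A null vector of the form has no component in `L(Q)`, so it is orthogonal to the annihilated
points; the vanishing weighted sum makes it orthogonal to the others. The data span the space, so it
is zero. -/
theorem TwoSubspacesCondition.posDef_blockCov {D N : ℕ} {x : Fin N → EuclideanSpace ℝ (Fin D)}
    (hx : TwoSubspacesCondition x) (Q : Matrix (Fin D) (Fin D) ℝ) : (blockCov x Q).PosDef := by
  refine posDef_of_inner_pos ?_ fun v hv => ?_
  · rw [Matrix.IsSymm, blockCov, Matrix.transpose_add, Matrix.transpose_mul, Matrix.transpose_mul,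
      (isSymm_projMatrix _).eq, (isSymm_projMatrix _).eq, (isSymm_weightedCov x Q).eq, mul_assoc]
  · rw [inner_blockCov]
    have hterm : ∀ i ∈ Finset.univ, 0 ≤ 1 / ‖matApply Q (x i)‖ *
        inner ℝ (x i) ((annihilatedSpan x Q)ᗮ.starProjection v) ^ 2 := fun i _ => by positivity
    have hsum := Finset.sum_nonneg hterm
    refine lt_of_le_of_ne (by positivity) fun h0 => hv ?_
    have hL : (annihilatedSpan x Q).starProjection v = 0 := by
      have : ‖(annihilatedSpan x Q).starProjection v‖ ^ 2 = 0 := by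
        nlinarith [sq_nonneg ‖(annihilatedSpan x Q).starProjection v‖]
      simpa using this
    rw [hL] at h0
    have hs0 : ∑ i, 1 / ‖matApply Q (x i)‖ *
        inner ℝ (x i) ((annihilatedSpan x Q)ᗮ.starProjection v) ^ 2 = 0 := by
      simpa using h0.symm
    rw [Finset.sum_eq_zero_iff_of_nonneg hterm] at hs0
    have hv' : (annihilatedSpan x Q)ᗮ.starProjection v = v := by
      have := Submodule.starProjection_add_starProjection_orthogonal
        (K := annihilatedSpan x Q) v
      rwa [hL, zero_add] at this
    have hmem : v ∈ (annihilatedSpan x Q)ᗮ := Submodule.starProjection_eq_self_iff.mp hv'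
    have htop := hx.eq_top (V := LinearMap.ker (innerₛₗ ℝ v)) fun i => by
      simp only [LinearMap.mem_ker, innerₛₗ_apply_apply]
      by_cases hi : matApply Q (x i) = 0
      · exact Submodule.inner_left_of_mem_orthogonal ((mem_annihilatedSpan_iff x Q i).mpr hi) hmem
      · have := hs0 i (Finset.mem_univ i)
        rw [hv'] at this
        rw [real_inner_comm]
        simpa [hi] using this
    have : v ∈ LinearMap.ker (innerₛₗ ℝ v) := htop ▸ Submodule.mem_top
    simpa using this

theorem inner_mul_mul_projMatrix {D : ℕ} (L : Submodule ℝ (EuclideanSpace ℝ (Fin D)))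
    (A : Matrix (Fin D) (Fin D) ℝ) (v : EuclideanSpace ℝ (Fin D)) :
    inner ℝ v (matApply (projMatrix L * A * projMatrix L) v) =
      inner ℝ (L.starProjection v) (matApply A (L.starProjection v)) := by
  rw [matApply_mul, matApply_mul, ← inner_matApply_left (isSymm_projMatrix _), matApply_projMatrix]

theorem Matrix.PosDef.inner_pos {D : ℕ} {A : Matrix (Fin D) (Fin D) ℝ} (hA : A.PosDef)
    {v : EuclideanSpace ℝ (Fin D)} (hv : v ≠ 0) : 0 < inner ℝ v (matApply A v) := by
  have := hA.dotProduct_mulVec_pos (x := v.ofLp) (by simpa using hv)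
  rwa [EuclideanSpace.inner_eq_star_dotProduct, ofLp_matApply, star_trivial, dotProduct_comm]

theorem Matrix.PosDef.isSymm {D : ℕ} {A : Matrix (Fin D) (Fin D) ℝ} (hA : A.PosDef) :
    A.IsSymm := by
  have := hA.isHermitian
  rwa [Matrix.IsHermitian, Matrix.conjTranspose_eq_transpose_of_trivial] at this

theorem isSymm_compressedInverse {D N : ℕ} {x : Fin N → EuclideanSpace ℝ (Fin D)}
    (hx : TwoSubspacesCondition x) (Q : Matrix (Fin D) (Fin D) ℝ) :
    (compressedInverse x Q).IsSymm := by
  rw [compressedInverse_eq, Matrix.IsSymm, Matrix.transpose_mul, Matrix.transpose_mul,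
    (isSymm_projMatrix _).eq, (hx.posDef_blockCov Q).inv.isSymm.eq, mul_assoc]

/-- Definiteness of the inverse on `L(Q)ᗮ` leaves no kernel beyond `L(Q)`. This is why the set of
annihilated data points is invariant under the iteration. -/
theorem matApply_compressedInverse_eq_zero_iff {D N : ℕ} {x : Fin N → EuclideanSpace ℝ (Fin D)}
    (hx : TwoSubspacesCondition x) (Q : Matrix (Fin D) (Fin D) ℝ)
    (v : EuclideanSpace ℝ (Fin D)) :
    matApply (compressedInverse x Q) v = 0 ↔ v ∈ annihilatedSpan x Q := by
  constructor
  · intro h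
    have h1 := inner_mul_mul_projMatrix (annihilatedSpan x Q)ᗮ (blockCov x Q)⁻¹ v
    rw [← compressedInverse_eq, h, inner_zero_right] at h1
    have h2 : (annihilatedSpan x Q)ᗮ.starProjection v = 0 := by
      by_contra hne
      exact ((hx.posDef_blockCov Q).inv.inner_pos hne).ne h1
    rwa [Submodule.starProjection_apply_eq_zero_iff, Submodule.orthogonal_orthogonal] at h2
  · intro h
    rw [compressedInverse_eq, matApply_mul, matApply_projMatrix,
      (Submodule.starProjection_apply_eq_zero_iff (K := (annihilatedSpan x Q)ᗮ)).mpr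
        (by rwa [Submodule.orthogonal_orthogonal])]
    simp [matApply]

/-- A positive semidefinite matrix of trace zero vanishes; then every data point would lie in
`L(Q)`, forcing `Q = 0` against unit trace. -/
theorem trace_compressedInverse_pos {D N : ℕ} {x : Fin N → EuclideanSpace ℝ (Fin D)}
    (hx : TwoSubspacesCondition x) {Q : Matrix (Fin D) (Fin D) ℝ} (hQ : Q ∈ traceOneSymm D) :
    0 < (compressedInverse x Q).trace := by
  have hpsd : (compressedInverse x Q).PosSemidef := by
    have := (hx.posDef_blockCov Q).inv.posSemidef.mul_mul_conjTranspose_same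
      (projMatrix (annihilatedSpan x Q)ᗮ)
    rwa [Matrix.conjTranspose_eq_transpose_of_trivial, (isSymm_projMatrix _).eq,
      ← compressedInverse_eq] at this
  refine lt_of_le_of_ne hpsd.trace_nonneg fun h0 => ?_
  rw [eq_comm, hpsd.trace_eq_zero_iff] at h0
  have hQ0 : Q = 0 := hx.eq_zero fun i => by
    rw [← mem_annihilatedSpan_iff x Q, ← matApply_compressedInverse_eq_zero_iff hx, h0]
    simp [matApply]
  have := hQ.2
  simp [hQ0] at this

theorem irlsStep_mem {D N : ℕ} {x : Fin N → EuclideanSpace ℝ (Fin D)}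
    (hx : TwoSubspacesCondition x) {Q : Matrix (Fin D) (Fin D) ℝ} (hQ : Q ∈ traceOneSymm D) :
    irlsStep x Q ∈ traceOneSymm D := by
  refine ⟨(isSymm_compressedInverse hx Q).smul _, ?_⟩
  rw [irlsStep, Matrix.trace_smul, smul_eq_mul,
    one_div_mul_cancel (trace_compressedInverse_pos hx hQ).ne']

theorem matApply_irlsStep_eq_zero_iff {D N : ℕ} {x : Fin N → EuclideanSpace ℝ (Fin D)}
    (hx : TwoSubspacesCondition x) {Q : Matrix (Fin D) (Fin D) ℝ} (hQ : Q ∈ traceOneSymm D)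
    (i : Fin N) : matApply (irlsStep x Q) (x i) = 0 ↔ matApply Q (x i) = 0 := by
  have := (trace_compressedInverse_pos hx hQ).ne'
  rw [irlsStep, matApply_smul, smul_eq_zero_iff_right (one_div_ne_zero this),
    matApply_compressedInverse_eq_zero_iff hx, mem_annihilatedSpan_iff]

/-- The stationarity condition that characterizes the IRLS step. -/
theorem sum_inner_irlsStep_eq_zero {D N : ℕ} {x : Fin N → EuclideanSpace ℝ (Fin D)}
    (hx : TwoSubspacesCondition x) (Q : Matrix (Fin D) (Fin D) ℝ)
    {Z : Matrix (Fin D) (Fin D) ℝ} (hZtr : Z.trace = 0)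
    (hZ : ∀ i, matApply Q (x i) = 0 → matApply Z (x i) = 0) :
    ∑ i, 1 / ‖matApply Q (x i)‖ *
      inner ℝ (matApply Z (x i)) (matApply (irlsStep x Q) (x i)) = 0 := by
  have hT : (irlsStep x Q).IsSymm := (isSymm_compressedInverse hx Q).smul _
  rw [← trace_mul_weightedCov_mul x Q hT, irlsStep]
  set P := projMatrix (annihilatedSpan x Q)ᗮ with hP
  set R := projMatrix (annihilatedSpan x Q) with hR
  have hZR : Z * R = 0 := matApply_ext fun v => by
    rw [matApply_mul, matApply_projMatrix]
    have := annihilatedSpan_le_ker x hZ (Submodule.starProjection_apply_mem _ v)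
    simpa [matApply] using this
  have hPR : P + R = 1 := projMatrix_orthogonal_add _
  have hZP : Z * P = Z := by
    have := congrArg (Z * ·) hPR
    simpa [mul_add, hZR] using this
  have hM : blockCov x Q * (blockCov x Q)⁻¹ = 1 :=
    Matrix.mul_nonsing_inv _ ((Matrix.isUnit_iff_isUnit_det _).mp (hx.posDef_blockCov Q).isUnit)
  have hPAP : P * weightedCov x Q * P = blockCov x Q - R := by
    rw [blockCov, ← hP, ← hR, add_sub_cancel_right]
  -- `Z` kills `L(Q)`, so it only sees the block of `A` that `B` inverts; hence `Z A B = Z`, whose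
  -- trace is zero.
  have key : Z * weightedCov x Q * compressedInverse x Q = Z := by
    calc Z * weightedCov x Q * compressedInverse x Q
        = Z * (P * weightedCov x Q * P) * (blockCov x Q)⁻¹ * P := by
          rw [compressedInverse_eq, ← hP]
          conv_lhs => rw [← hZP]
          simp only [mul_assoc]
      _ = Z * (blockCov x Q * (blockCov x Q)⁻¹) * P - Z * R * (blockCov x Q)⁻¹ * P := by
          rw [hPAP]; noncomm_ring
      _ = Z := by rw [hM, hZR, mul_one, hZP]; simp
  rw [Matrix.mul_smul, key, Matrix.trace_smul, hZtr, smul_zero]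

/-! ### Two general analytic lemmas -/

open Filter in
/-- A bounded sequence with vanishing increments and finitely many cluster points converges. -/
theorem exists_tendsto_of_finite_clusterPt {E : Type*} [MetricSpace E] [ProperSpace E] {u : ℕ → E}
    (hb : Bornology.IsBounded (Set.range u))
    (hd : Tendsto (fun n => dist (u (n + 1)) (u n)) atTop (𝓝 0))
    (hfin : {a | MapClusterPt a atTop u}.Finite) :
    ∃ a, MapClusterPt a atTop u ∧ Tendsto u atTop (𝓝 a) := by
  obtain ⟨a, -, ha⟩ := hb.isCompact_closure.exists_mapClusterPt (f := atTop) (u := u)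
    (tendsto_principal.mpr (Eventually.of_forall fun n => subset_closure ⟨n, rfl⟩))
  refine ⟨a, ha, Metric.tendsto_atTop'.mpr fun ε hε => ?_⟩
  have hclosed : IsClosed ({a | MapClusterPt a atTop u} \ {a}) := (hfin.sdiff).isClosed
  obtain ⟨δ, hδ, hball⟩ := Metric.isOpen_iff.mp hclosed.isOpen_compl a (by simp)
  -- The annulus between radii `r` and `2r` contains no cluster point, so by compactness the
  -- sequence eventually avoids it. Steps shorter than `r` cannot jump across it, so a late visit to
  -- the inner ball is permanent.
  set r := min δ ε / 3 with hr
  have hmin : 0 < min δ ε := lt_min hδ hε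
  have hr0 : 0 < r := by positivity
  have hrδ : 2 * r < δ := by have := min_le_left δ ε; linarith
  have hrε : r < ε := by have := min_le_right δ ε; linarith
  have hK : IsCompact (Metric.closedBall a (2 * r) \ Metric.ball a r) :=
    (isCompact_closedBall a (2 * r)).diff Metric.isOpen_ball
  have hev : ∀ᶠ n in atTop, u n ∉ Metric.closedBall a (2 * r) \ Metric.ball a r := by
    by_contra hnot
    have hfreq : ∃ᶠ n in atTop, u n ∈ Metric.closedBall a (2 * r) \ Metric.ball a r := by
      simpa [Filter.Frequently] using hnot
    obtain ⟨b, hbK, hbc⟩ := hK.exists_mapClusterPt_of_frequently hfreq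
    have hbδ : b ∈ Metric.ball a δ := lt_of_le_of_lt hbK.1 hrδ
    refine hball hbδ ⟨hbc, ?_⟩
    rintro rfl
    exact hbK.2 (Metric.mem_ball_self hr0)
  obtain ⟨n₁, h₁⟩ := eventually_atTop.mp (hev.and (hd.eventually (gt_mem_nhds hr0)))
  obtain ⟨n₂, hn₂, h₂⟩ := frequently_atTop.mp
    (ha.frequently (Metric.ball_mem_nhds a hr0)) n₁
  have hmain : ∀ n, n₂ ≤ n → u n ∈ Metric.ball a r := by
    intro n hn
    induction n, hn using Nat.le_induction with
    | base => exact h₂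
    | succ n hn ih =>
      by_contra hout
      refine (h₁ (n + 1) (by omega)).1 ⟨?_, hout⟩
      have hs := (h₁ n (by omega)).2
      have := dist_triangle (u (n + 1)) (u n) a
      rw [Metric.mem_ball] at ih
      rw [Metric.mem_closedBall]
      linarith
  exact ⟨n₂, fun n hn => (hmain n hn.le).trans hrε⟩

/-- A positive continuous homogeneous function on a finite-dimensional subspace dominates a
multiple of the corresponding power of the norm. -/
theorem exists_pos_mul_norm_pow_le {E : Type*} [NormedAddCommGroup E] [NormedSpace ℝ E]
    [FiniteDimensional ℝ E] (K : Submodule ℝ E) {f : E → ℝ} {p : ℕ} (hp : p ≠ 0)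
    (hf : Continuous f) (hhom : ∀ t v, 0 ≤ t → f (t • v) = t ^ p * f v)
    (hpos : ∀ v ∈ K, v ≠ 0 → 0 < f v) : ∃ c, 0 < c ∧ ∀ v ∈ K, c * ‖v‖ ^ p ≤ f v := by
  have := FiniteDimensional.proper ℝ E
  have hcomp : IsCompact (Metric.sphere (0 : E) 1 ∩ K) :=
    (isCompact_sphere 0 1).inter_right K.closed_of_finiteDimensional
  have hf0 : f 0 = 0 := by simpa [hp] using hhom 0 0 le_rfl
  obtain ⟨c, hc, hle⟩ : ∃ c, 0 < c ∧ ∀ v ∈ Metric.sphere (0 : E) 1 ∩ K, c ≤ f v := by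
    rcases (Metric.sphere (0 : E) 1 ∩ K).eq_empty_or_nonempty with h | h
    · exact ⟨1, one_pos, by simp [h]⟩
    · obtain ⟨v, hv, hmin⟩ := hcomp.exists_isMinOn h hf.continuousOn
      refine ⟨f v, hpos v hv.2 ?_, fun w hw => hmin hw⟩
      rintro rfl
      simpa using hv.1
  refine ⟨c, hc, fun v hv => ?_⟩
  by_cases h0 : v = 0
  · simp [h0, hf0, hp]
  have hn : 0 < ‖v‖ := norm_pos_iff.mpr h0
  have h1 := hle (‖v‖⁻¹ • v) ⟨by simp [norm_smul, hn.ne'], K.smul_mem _ hv⟩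
  have h2 := hhom ‖v‖ (‖v‖⁻¹ • v) hn.le
  rw [smul_inv_smul₀ hn.ne'] at h2
  rw [h2, mul_comm]
  gcongr

-- Coercivity and strict convexity, in the entrywise sup norm

attribute [local instance] Matrix.normedAddCommGroup Matrix.normedSpace

theorem continuous_matApply {D : ℕ} (v : EuclideanSpace ℝ (Fin D)) :
    Continuous fun A : Matrix (Fin D) (Fin D) ℝ => matApply A v := by
  have h : IsLinearMap ℝ fun A : Matrix (Fin D) (Fin D) ℝ => matApply A v :=
    ⟨fun A B => matApply_add A B v, fun c A => matApply_smul c A v⟩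
  exact (h.mk' _).continuous_of_finiteDimensional

theorem continuous_objective {D N : ℕ} (x : Fin N → EuclideanSpace ℝ (Fin D)) :
    Continuous (objective x) :=
  continuous_finsetSum _ fun i _ => (continuous_matApply (x i)).norm

theorem norm_matApply_le_objective {D N : ℕ} (x : Fin N → EuclideanSpace ℝ (Fin D))
    (A : Matrix (Fin D) (Fin D) ℝ) (i : Fin N) : ‖matApply A (x i)‖ ≤ objective x A :=
  Finset.single_le_sum (f := fun i => ‖matApply A (x i)‖) (fun _ _ => norm_nonneg _)
    (Finset.mem_univ i)

theorem TwoSubspacesCondition.objective_pos {D N : ℕ} {x : Fin N → EuclideanSpace ℝ (Fin D)}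
    (hx : TwoSubspacesCondition x) {A : Matrix (Fin D) (Fin D) ℝ} (hA : A ≠ 0) :
    0 < objective x A := by
  by_contra! h
  exact hA (hx.eq_zero fun i =>
    norm_le_zero_iff.mp ((norm_matApply_le_objective x A i).trans h))

/-- `F` is homogeneous of degree one and positive away from zero, because the data span the space.
-/
theorem TwoSubspacesCondition.exists_mul_norm_le_objective {D N : ℕ}
    {x : Fin N → EuclideanSpace ℝ (Fin D)} (hx : TwoSubspacesCondition x) :
    ∃ c, 0 < c ∧ ∀ A : Matrix (Fin D) (Fin D) ℝ, c * ‖A‖ ≤ objective x A := by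
  obtain ⟨c, hc, h⟩ := exists_pos_mul_norm_pow_le (⊤ : Submodule ℝ (Matrix (Fin D) (Fin D) ℝ))
    one_ne_zero (continuous_objective x) (fun t A ht => by
      simp [objective, matApply_smul, norm_smul, abs_of_nonneg ht, Finset.mul_sum])
    fun A _ hA => hx.objective_pos hA
  exact ⟨c, hc, fun A => by simpa using h A trivial⟩

theorem isClosed_traceOneSymm (D : ℕ) : IsClosed (traceOneSymm D) := by
  refine IsClosed.inter (s₁ := {Q : Matrix (Fin D) (Fin D) ℝ | Q.IsSymm}) (s₂ := {Q : Matrix (Fin D) (Fin D) ℝ | Q.trace = 1}) ?_ ?_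
  · exact isClosed_eq (continuous_id.matrix_transpose) continuous_id
  · exact isClosed_eq (continuous_id.matrix_trace) continuous_const

theorem TwoSubspacesCondition.exists_isObjectiveMinimizer {D N : ℕ}
    {x : Fin N → EuclideanSpace ℝ (Fin D)} (hx : TwoSubspacesCondition x)
    (hne : (traceOneSymm D).Nonempty) : ∃ A, IsObjectiveMinimizer x A := by
  obtain ⟨c, hc, hle⟩ := hx.exists_mul_norm_le_objective
  obtain ⟨A₀, hA₀⟩ := hne
  have hcomp : IsCompact (traceOneSymm D ∩ Metric.closedBall 0 (objective x A₀ / c)) :=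
    (isCompact_closedBall _ _).inter_left (isClosed_traceOneSymm D)
  have hbound : ∀ A, objective x A ≤ objective x A₀ →
      A ∈ Metric.closedBall 0 (objective x A₀ / c) := fun A hA => by
    rw [mem_closedBall_zero_iff, le_div_iff₀ hc, mul_comm]
    exact (hle A).trans hA
  obtain ⟨A, hA, hmin⟩ := hcomp.exists_isMinOn ⟨A₀, hA₀, hbound A₀ le_rfl⟩
    (continuous_objective x).continuousOn
  refine ⟨A, hA.1, fun B hB => ?_⟩
  rcases le_total (objective x B) (objective x A₀) with h | h
  · exact hmin ⟨hB, hbound B h⟩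
  · exact (hmin ⟨hA₀, hbound A₀ le_rfl⟩).trans h

theorem traceOneSymm_affine {D : ℕ} {A B : Matrix (Fin D) (Fin D) ℝ} (hA : A ∈ traceOneSymm D)
    (hB : B ∈ traceOneSymm D) {a b : ℝ} (hab : a + b = 1) : a • A + b • B ∈ traceOneSymm D :=
  ⟨(hA.1.smul a).add (hB.1.smul b), by simp [Matrix.trace_add, Matrix.trace_smul, hA.2, hB.2, hab]⟩

/-- Strict convexity: if the midpoint does not improve on `A` and `B`, then `A = B`. -/
theorem TwoSubspacesCondition.eq_of_objective_midpoint {D N : ℕ}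
    {x : Fin N → EuclideanSpace ℝ (Fin D)} (hx : TwoSubspacesCondition x)
    {A B : Matrix (Fin D) (Fin D) ℝ} (hA : A ∈ traceOneSymm D) (hB : B ∈ traceOneSymm D)
    (h : objective x A + objective x B ≤
      2 * objective x ((1 / 2 : ℝ) • A + (1 / 2 : ℝ) • B)) : A = B := by
  refine hx.eq_of_dependent hA hB fun i => ?_
  have hmid : 2 * objective x ((1 / 2 : ℝ) • A + (1 / 2 : ℝ) • B) =
      ∑ i, ‖matApply A (x i) + matApply B (x i)‖ := by
    rw [objective, Finset.mul_sum]
    refine Finset.sum_congr rfl fun i _ => ?_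
    rw [matApply_add, matApply_smul, matApply_smul, ← smul_add, norm_smul]
    norm_num [← mul_assoc]
  have heq : ∑ i, ‖matApply A (x i) + matApply B (x i)‖ =
      ∑ i, (‖matApply A (x i)‖ + ‖matApply B (x i)‖) := by
    refine le_antisymm (Finset.sum_le_sum fun i _ => norm_add_le _ _) ?_
    rwa [Finset.sum_add_distrib, ← hmid]
  -- Equality of the sums forces equality in each triangle inequality, so `A x_i` and `B x_i` lie on
  -- a common ray and are dependent.
  have hi := (Finset.sum_eq_sum_iff_of_le fun i _ => norm_add_le _ _).mp heq i (Finset.mem_univ i)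
  rcases sameRay_iff_norm_add.mpr hi with h | h | ⟨a, b, ha, hb, h⟩
  · exact ⟨1, 0, by simp, by simp [h]⟩
  · exact ⟨0, 1, by simp, by simp [h]⟩
  · exact ⟨a, b, Or.inl ha.ne', h⟩

theorem TwoSubspacesCondition.isObjectiveMinimizer_unique {D N : ℕ}
    {x : Fin N → EuclideanSpace ℝ (Fin D)} (hx : TwoSubspacesCondition x)
    {A B : Matrix (Fin D) (Fin D) ℝ} (hA : IsObjectiveMinimizer x A)
    (hB : IsObjectiveMinimizer x B) : A = B := by
  refine hx.eq_of_objective_midpoint hA.1 hB.1 ?_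
  have hmem := traceOneSymm_affine hA.1 hB.1 (a := 1 / 2) (b := 1 / 2) (by norm_num)
  have h1 := hA.2 hmem
  have h2 := hB.2 hmem
  change objective x A ≤ _ at h1
  change objective x B ≤ _ at h2
  linarith

/-! ### Subgradients, stationary matrices and descent -/

/-- The subgradient inequality, term by term from Cauchy–Schwarz. At points annihilated by `A` the
zero weight selects the subgradient `0` of the norm. -/
theorem objective_add_sum_inner_le {D N : ℕ} (x : Fin N → EuclideanSpace ℝ (Fin D))
    (A B : Matrix (Fin D) (Fin D) ℝ) :
    objective x A + ∑ i, 1 / ‖matApply A (x i)‖ *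
      inner ℝ (matApply (B - A) (x i)) (matApply A (x i)) ≤ objective x B := by
  rw [objective, objective, ← Finset.sum_add_distrib]
  refine Finset.sum_le_sum fun i _ => ?_
  rw [matApply_sub, inner_sub_left, real_inner_self_eq_norm_sq]
  by_cases h : ‖matApply A (x i)‖ = 0
  · simp [h]
  · have hpos : 0 < ‖matApply A (x i)‖ := lt_of_le_of_ne (norm_nonneg _) (Ne.symm h)
    have := real_inner_le_norm (matApply B (x i)) (matApply A (x i))
    have h2 : 1 / ‖matApply A (x i)‖ * inner ℝ (matApply B (x i)) (matApply A (x i)) ≤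
        ‖matApply B (x i)‖ := by
      rw [one_div_mul_eq_div, div_le_iff₀ hpos]
      exact this
    have h3 : 1 / ‖matApply A (x i)‖ * ‖matApply A (x i)‖ ^ 2 = ‖matApply A (x i)‖ := by
      field_simp
    rw [mul_sub, h3]
    linarith

/-- First-order stationarity of `objective` at `A`, relative to the symmetric matrices of unit
trace that annihilate the data points annihilated by `A`. -/
def IsObjectiveStationary {D N : ℕ} (x : Fin N → EuclideanSpace ℝ (Fin D))
    (A : Matrix (Fin D) (Fin D) ℝ) : Prop :=
  ∀ Z : Matrix (Fin D) (Fin D) ℝ, Z.IsSymm → Z.trace = 0 →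
    (∀ i, matApply A (x i) = 0 → matApply Z (x i) = 0) →
      ∑ i, 1 / ‖matApply A (x i)‖ * inner ℝ (matApply Z (x i)) (matApply A (x i)) = 0

theorem IsObjectiveStationary.objective_le {D N : ℕ} {x : Fin N → EuclideanSpace ℝ (Fin D)}
    {A : Matrix (Fin D) (Fin D) ℝ} (h : IsObjectiveStationary x A) (hA : A ∈ traceOneSymm D)
    {B : Matrix (Fin D) (Fin D) ℝ} (hB : B ∈ traceOneSymm D)
    (hAB : ∀ i, matApply A (x i) = 0 → matApply B (x i) = 0) : objective x A ≤ objective x B := by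
  have := objective_add_sum_inner_le x A B
  rwa [h (B - A) (hB.1.sub hA.1) (by rw [Matrix.trace_sub, hA.2, hB.2, sub_self])
    fun i hi => by rw [matApply_sub, hi, hAB i hi, sub_self], add_zero] at this

/-- The midpoint annihilates the common points, so neither `A` nor `B` exceeds it in objective
value; strict convexity concludes. -/
theorem TwoSubspacesCondition.isStationary_unique {D N : ℕ}
    {x : Fin N → EuclideanSpace ℝ (Fin D)} (hx : TwoSubspacesCondition x)
    {A B : Matrix (Fin D) (Fin D) ℝ} (hA : A ∈ traceOneSymm D) (hB : B ∈ traceOneSymm D)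
    (hsA : IsObjectiveStationary x A) (hsB : IsObjectiveStationary x B)
    (hAB : ∀ i, matApply A (x i) = 0 ↔ matApply B (x i) = 0) : A = B := by
  refine hx.eq_of_objective_midpoint hA hB ?_
  have hmem := traceOneSymm_affine hA hB (a := 1 / 2) (b := 1 / 2) (by norm_num)
  have h1 := hsA.objective_le hA hmem fun i hi => by
    rw [matApply_add, matApply_smul, matApply_smul, hi, (hAB i).mp hi]; simp
  have h2 := hsB.objective_le hB hmem fun i hi => by
    rw [matApply_add, matApply_smul, matApply_smul, hi, (hAB i).mpr hi]; simp
  linarith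

theorem TwoSubspacesCondition.finite_stationary {D N : ℕ}
    {x : Fin N → EuclideanSpace ℝ (Fin D)} (hx : TwoSubspacesCondition x) :
    {A | A ∈ traceOneSymm D ∧ IsObjectiveStationary x A}.Finite := by
  refine Set.Finite.of_finite_image (f := fun A => {i | matApply A (x i) = 0}) (Set.toFinite _) ?_
  intro A hA B hB h
  exact hx.isStationary_unique hA.1 hB.1 hA.2 hB.2 fun i => Set.ext_iff.mp h i

/-- Orthogonality turns the left side into the decrease of the weighted quadratic form, and `(s² -
t²) / s ≤ 2 (s - t)` for `s > 0` compares that with the decrease of `F`. -/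
theorem sum_normSq_le_objective_sub {D N : ℕ} (x : Fin N → EuclideanSpace ℝ (Fin D))
    {A T : Matrix (Fin D) (Fin D) ℝ} (hAT : ∀ i, matApply A (x i) = 0 → matApply T (x i) = 0)
    (h : ∑ i, 1 / ‖matApply A (x i)‖ *
      inner ℝ (matApply (A - T) (x i)) (matApply T (x i)) = 0) :
    ∑ i, 1 / ‖matApply A (x i)‖ * ‖matApply (A - T) (x i)‖ ^ 2 ≤
      2 * (objective x A - objective x T) := by
  have hterm : ∀ i, 1 / ‖matApply A (x i)‖ * ‖matApply (A - T) (x i)‖ ^ 2 +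
      2 * (1 / ‖matApply A (x i)‖ * inner ℝ (matApply (A - T) (x i)) (matApply T (x i))) ≤
      2 * (‖matApply A (x i)‖ - ‖matApply T (x i)‖) := by
    intro i
    by_cases h0 : matApply A (x i) = 0
    · simp [h0, hAT i h0]
    have hpos : 0 < ‖matApply A (x i)‖ := norm_pos_iff.mpr h0
    have hexp : ‖matApply (A - T) (x i)‖ ^ 2 +
        2 * inner ℝ (matApply (A - T) (x i)) (matApply T (x i)) =
        ‖matApply A (x i)‖ ^ 2 - ‖matApply T (x i)‖ ^ 2 := by
      rw [matApply_sub, norm_sub_sq_real, inner_sub_left, real_inner_self_eq_norm_sq]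
      ring
    have : 1 / ‖matApply A (x i)‖ * ‖matApply (A - T) (x i)‖ ^ 2 +
        2 * (1 / ‖matApply A (x i)‖ * inner ℝ (matApply (A - T) (x i)) (matApply T (x i))) =
        (‖matApply A (x i)‖ ^ 2 - ‖matApply T (x i)‖ ^ 2) / ‖matApply A (x i)‖ := by
      rw [← hexp]; ring
    rw [this, div_le_iff₀ hpos]
    nlinarith [sq_nonneg (‖matApply A (x i)‖ - ‖matApply T (x i)‖)]
  have hsum := Finset.sum_le_sum fun i (_ : i ∈ Finset.univ) => hterm i
  rw [Finset.sum_add_distrib, ← Finset.mul_sum, ← Finset.mul_sum, h, Finset.sum_sub_distrib] at hsum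
  simpa [objective] using hsum

/-! ### Norm comparisons and quadratic growth -/

theorem LinearMap.exists_norm_le_mul_norm {E F : Type*} [NormedAddCommGroup E] [NormedSpace ℝ E]
    [FiniteDimensional ℝ E] [NormedAddCommGroup F] [NormedSpace ℝ F] (f : E →ₗ[ℝ] F) :
    ∃ C, 0 ≤ C ∧ ∀ v, ‖f v‖ ≤ C * ‖v‖ :=
  ⟨‖f.toContinuousLinearMap‖, norm_nonneg _, f.toContinuousLinearMap.le_opNorm⟩

theorem exists_norm_matApply_le {D : ℕ} (v : EuclideanSpace ℝ (Fin D)) :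
    ∃ C, 0 ≤ C ∧ ∀ A : Matrix (Fin D) (Fin D) ℝ, ‖matApply A v‖ ≤ C * ‖A‖ := by
  have h : IsLinearMap ℝ fun A : Matrix (Fin D) (Fin D) ℝ => matApply A v :=
    ⟨fun A B => matApply_add A B v, fun c A => matApply_smul c A v⟩
  exact (h.mk' _).exists_norm_le_mul_norm

theorem exists_sum_normSq_le {D N : ℕ} (x : Fin N → EuclideanSpace ℝ (Fin D)) :
    ∃ C, 0 ≤ C ∧ ∀ A : Matrix (Fin D) (Fin D) ℝ, ∑ i, ‖matApply A (x i)‖ ^ 2 ≤ C * ‖A‖ ^ 2 := by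
  choose C hC h using fun i => exists_norm_matApply_le (x i)
  refine ⟨∑ i, C i ^ 2, Finset.sum_nonneg fun i _ => sq_nonneg _, fun A => ?_⟩
  rw [Finset.sum_mul]
  refine Finset.sum_le_sum fun i _ => ?_
  rw [← mul_pow]
  exact pow_le_pow_left₀ (norm_nonneg _) (h i A) 2

theorem TwoSubspacesCondition.exists_mul_norm_sq_le_sum {D N : ℕ}
    {x : Fin N → EuclideanSpace ℝ (Fin D)} (hx : TwoSubspacesCondition x) :
    ∃ c, 0 < c ∧ ∀ A : Matrix (Fin D) (Fin D) ℝ, c * ‖A‖ ^ 2 ≤ ∑ i, ‖matApply A (x i)‖ ^ 2 := by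
  obtain ⟨c, hc, h⟩ := exists_pos_mul_norm_pow_le (⊤ : Submodule ℝ (Matrix (Fin D) (Fin D) ℝ))
    two_ne_zero (f := fun A => ∑ i, ‖matApply A (x i)‖ ^ 2)
    (continuous_finsetSum _ fun i _ => (continuous_matApply (x i)).norm.pow 2) (fun t A ht => by
      simp [matApply_smul, norm_smul, Finset.mul_sum, mul_pow])
    fun A _ hA => by
      refine lt_of_le_of_ne (Finset.sum_nonneg fun i _ => sq_nonneg _) fun h0 => hA ?_
      rw [eq_comm, Finset.sum_eq_zero_iff_of_nonneg fun i _ => sq_nonneg _] at h0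
      exact hx.eq_zero fun i => by simpa using h0 i (Finset.mem_univ i)
  exact ⟨c, hc, fun A => h A trivial⟩

theorem frobNorm_le {D : ℕ} (A : Matrix (Fin D) (Fin D) ℝ) : frobNorm A ≤ D * ‖A‖ := by
  refine Real.sqrt_le_iff.mpr ⟨by positivity, ?_⟩
  have h : ∀ i j, A i j ^ 2 ≤ ‖A‖ ^ 2 := fun i j => by
    rw [← sq_abs, ← Real.norm_eq_abs]
    exact pow_le_pow_left₀ (norm_nonneg _) (Matrix.norm_entry_le_entrywise_sup_norm A) 2
  calc ∑ i, ∑ j, A i j ^ 2 ≤ ∑ _i : Fin D, ∑ _j : Fin D, ‖A‖ ^ 2 :=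
        Finset.sum_le_sum fun i _ => Finset.sum_le_sum fun j _ => h i j
    _ = (D * ‖A‖) ^ 2 := by simp; ring

/-- The symmetric matrices of trace zero. -/
def tracelessSymm (D : ℕ) : Submodule ℝ (Matrix (Fin D) (Fin D) ℝ) where
  carrier := {Z | Z.IsSymm ∧ Z.trace = 0}
  add_mem' ha hb := ⟨ha.1.add hb.1, by rw [Matrix.trace_add, ha.2, hb.2, add_zero]⟩
  zero_mem' := ⟨Matrix.isSymm_zero, Matrix.trace_zero _ _⟩
  smul_mem' c _ ha := ⟨ha.1.smul c, by rw [Matrix.trace_smul, ha.2, smul_zero]⟩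

theorem sub_mem_tracelessSymm {D : ℕ} {A B : Matrix (Fin D) (Fin D) ℝ} (hA : A ∈ traceOneSymm D)
    (hB : B ∈ traceOneSymm D) : A - B ∈ tracelessSymm D :=
  ⟨hA.1.sub hB.1, by rw [Matrix.trace_sub, hA.2, hB.2, sub_self]⟩

/-- The Euclidean norm lies above its tangent by at least a quadratic in the transverse part of
the increment. -/
theorem norm_sq_transverse_le {E : Type*} [NormedAddCommGroup E] [InnerProductSpace ℝ E]
    {u : E} (hu : u ≠ 0) (v : E) :
    ‖v - (inner ℝ v u / ‖u‖ ^ 2) • u‖ ^ 2 ≤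
      2 * ‖u + v‖ * (‖u + v‖ - ‖u‖ - 1 / ‖u‖ * inner ℝ v u) := by
  have hpos : 0 < ‖u‖ := norm_pos_iff.mpr hu
  set a := inner ℝ v u / ‖u‖ with ha
  have hq : ‖v - (inner ℝ v u / ‖u‖ ^ 2) • u‖ ^ 2 = ‖v‖ ^ 2 - a ^ 2 := by
    rw [norm_sub_sq_real, real_inner_smul_right, norm_smul, Real.norm_eq_abs, mul_pow, sq_abs, ha]
    field_simp
    ring
  have hR : ‖u + v‖ ^ 2 = ‖u‖ ^ 2 + 2 * (a * ‖u‖) + ‖v‖ ^ 2 := by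
    rw [norm_add_sq_real, ha, div_mul_cancel₀ _ hpos.ne', real_inner_comm]
  -- With `R = ‖u + v‖` and `s = ‖u‖ + a`, the left side is `R² - s²` and the right side `2R(R -
  -- s)`; they differ by `(R - s)²`.
  rw [hq, one_div_mul_eq_div, ← ha]
  nlinarith [sq_nonneg (‖u + v‖ - ‖u‖ - a)]

/-- Stationarity removes the linear term, leaving the transverse parts of `(B - A) x_i`. Their
squared norms sum to a definite form on traceless symmetric matrices: if all vanish, `A x_i` and `B
x_i` are dependent for every `i`. The factor `F(B)` bounds `‖B x_i‖` and makes the estimate global.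
-/
theorem TwoSubspacesCondition.exists_quadratic_growth {D N : ℕ}
    {x : Fin N → EuclideanSpace ℝ (Fin D)} (hx : TwoSubspacesCondition x)
    {A : Matrix (Fin D) (Fin D) ℝ} (hA : A ∈ traceOneSymm D) (hs : IsObjectiveStationary x A)
    (h0 : ∀ i, matApply A (x i) ≠ 0) :
    ∃ m, 0 < m ∧ ∀ B ∈ traceOneSymm D,
      m * ‖B - A‖ ^ 2 ≤ objective x B * (objective x B - objective x A) := by
  have hcont : ∀ i, Continuous fun Z : Matrix (Fin D) (Fin D) ℝ => matApply Z (x i) -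
      (inner ℝ (matApply Z (x i)) (matApply A (x i)) / ‖matApply A (x i)‖ ^ 2) •
        matApply A (x i) := fun i => by
    have := continuous_matApply (x i)
    fun_prop
  obtain ⟨m, hm, hle⟩ := exists_pos_mul_norm_pow_le (tracelessSymm D) two_ne_zero
    (f := fun Z => ∑ i, ‖matApply Z (x i) -
      (inner ℝ (matApply Z (x i)) (matApply A (x i)) / ‖matApply A (x i)‖ ^ 2) •
        matApply A (x i)‖ ^ 2)
    (continuous_finsetSum _ fun i _ => (hcont i).norm.pow 2)
    (fun t Z ht => by
      rw [Finset.mul_sum]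
      refine Finset.sum_congr rfl fun i _ => ?_
      rw [matApply_smul, real_inner_smul_left, mul_div_assoc, ← smul_smul, ← smul_sub, norm_smul,
        mul_pow, Real.norm_eq_abs, sq_abs])
    fun Z hZ hne => by
      refine lt_of_le_of_ne (Finset.sum_nonneg fun i _ => sq_nonneg _) fun hz => hne ?_
      rw [eq_comm, Finset.sum_eq_zero_iff_of_nonneg fun i _ => sq_nonneg _] at hz
      have hB : A + Z ∈ traceOneSymm D :=
        ⟨hA.1.add hZ.1, by rw [Matrix.trace_add, hA.2, hZ.2, add_zero]⟩
      have := hx.eq_of_dependent hA hB fun i => by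
        have hi := hz i (Finset.mem_univ i)
        rw [sq_eq_zero_iff, norm_eq_zero, sub_eq_zero] at hi
        refine ⟨1 + inner ℝ (matApply Z (x i)) (matApply A (x i)) / ‖matApply A (x i)‖ ^ 2, 1,
          by simp, ?_⟩
        rw [matApply_add, add_smul, ← hi, one_smul, one_smul]
      simpa using this
  refine ⟨m / 2, by positivity, fun B hB => ?_⟩
  have hZ := sub_mem_tracelessSymm hB hA
  have hst := hs (B - A) hZ.1 hZ.2 fun i hi => absurd hi (h0 i)
  have hterm : ∀ i, ‖matApply (B - A) (x i) -
      (inner ℝ (matApply (B - A) (x i)) (matApply A (x i)) / ‖matApply A (x i)‖ ^ 2) •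
        matApply A (x i)‖ ^ 2 ≤ 2 * objective x B * (‖matApply B (x i)‖ - ‖matApply A (x i)‖ -
          1 / ‖matApply A (x i)‖ * inner ℝ (matApply (B - A) (x i)) (matApply A (x i))) := by
    intro i
    have h1 := norm_sq_transverse_le (h0 i) (matApply (B - A) (x i))
    have hadd : matApply A (x i) + matApply (B - A) (x i) = matApply B (x i) := by
      rw [matApply_sub]; abel
    rw [hadd] at h1
    -- Enlarging `‖B x_i‖` to `F(B)` needs a nonnegative tangent gap. This follows by dividing by
    -- `‖B x_i‖`, except when that norm is zero, where the gap is computed to be zero.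
    by_cases hb : ‖matApply B (x i)‖ = 0
    · have htan : 0 ≤ ‖matApply B (x i)‖ - ‖matApply A (x i)‖ -
          1 / ‖matApply A (x i)‖ * inner ℝ (matApply (B - A) (x i)) (matApply A (x i)) := by
        have hpos : 0 < ‖matApply A (x i)‖ := norm_pos_iff.mpr (h0 i)
        rw [norm_eq_zero] at hb
        rw [matApply_sub, hb, zero_sub, inner_neg_left, real_inner_self_eq_norm_sq]
        apply le_of_eq
        field_simp
        simp
      have hF : 0 ≤ objective x B := Finset.sum_nonneg fun i _ => norm_nonneg _
      rw [hb] at h1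
      refine h1.trans ?_
      rw [mul_zero, zero_mul]
      positivity
    · have hbpos : 0 < ‖matApply B (x i)‖ := lt_of_le_of_ne (norm_nonneg _) (Ne.symm hb)
      have htan : 0 ≤ ‖matApply B (x i)‖ - ‖matApply A (x i)‖ -
          1 / ‖matApply A (x i)‖ * inner ℝ (matApply (B - A) (x i)) (matApply A (x i)) := by
        have := (sq_nonneg _).trans h1
        exact nonneg_of_mul_nonneg_right this (by positivity)
      exact h1.trans (mul_le_mul_of_nonneg_right
        (mul_le_mul_of_nonneg_left (norm_matApply_le_objective x B i) zero_le_two) htan)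
  have hsum := Finset.sum_le_sum fun i (_ : i ∈ Finset.univ) => hterm i
  rw [← Finset.mul_sum, Finset.sum_sub_distrib, Finset.sum_sub_distrib, hst, sub_zero] at hsum
  have h2 := (hle _ hZ).trans hsum
  change _ ≤ 2 * objective x B * (objective x B - objective x A) at h2
  linarith

/-! ### The IRLS sequence: descent, convergence and rate -/

section Sequence

open Filter

variable {D N : ℕ} {x : Fin N → EuclideanSpace ℝ (Fin D)} {Q : ℕ → Matrix (Fin D) (Fin D) ℝ}

theorem irls_mem (hx : TwoSubspacesCondition x) (hQ₀ : Q 0 ∈ traceOneSymm D)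
    (hQ : ∀ k, Q (k + 1) = irlsStep x (Q k)) (k : ℕ) : Q k ∈ traceOneSymm D := by
  induction k with
  | zero => exact hQ₀
  | succ k ih => rw [hQ]; exact irlsStep_mem hx ih

theorem matApply_irls_eq_zero_iff (hx : TwoSubspacesCondition x) (hQ₀ : Q 0 ∈ traceOneSymm D)
    (hQ : ∀ k, Q (k + 1) = irlsStep x (Q k)) (k : ℕ) (i : Fin N) :
    matApply (Q k) (x i) = 0 ↔ matApply (Q 0) (x i) = 0 := by
  induction k with
  | zero => rfl
  | succ k ih => rw [hQ, matApply_irlsStep_eq_zero_iff hx (irls_mem hx hQ₀ hQ k), ih]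

theorem sum_inner_irls_eq_zero (hx : TwoSubspacesCondition x)
    (hQ : ∀ k, Q (k + 1) = irlsStep x (Q k)) (k : ℕ) {Z : Matrix (Fin D) (Fin D) ℝ}
    (hZtr : Z.trace = 0) (hZ : ∀ i, matApply (Q k) (x i) = 0 → matApply Z (x i) = 0) :
    ∑ i, 1 / ‖matApply (Q k) (x i)‖ *
      inner ℝ (matApply Z (x i)) (matApply (Q (k + 1)) (x i)) = 0 := by
  rw [hQ]
  exact sum_inner_irlsStep_eq_zero hx (Q k) hZtr hZ

theorem irls_decrease (hx : TwoSubspacesCondition x) (hQ₀ : Q 0 ∈ traceOneSymm D)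
    (hQ : ∀ k, Q (k + 1) = irlsStep x (Q k)) (k : ℕ) :
    ∑ i, 1 / ‖matApply (Q k) (x i)‖ * ‖matApply (Q k - Q (k + 1)) (x i)‖ ^ 2 ≤
      2 * (objective x (Q k) - objective x (Q (k + 1))) := by
  have hann : ∀ i, matApply (Q k) (x i) = 0 → matApply (Q (k + 1)) (x i) = 0 := fun i hi => by
    rwa [matApply_irls_eq_zero_iff hx hQ₀ hQ] at hi ⊢
  refine sum_normSq_le_objective_sub x hann (sum_inner_irls_eq_zero hx hQ k ?_ fun i hi => ?_)
  · exact (sub_mem_tracelessSymm (irls_mem hx hQ₀ hQ k) (irls_mem hx hQ₀ hQ (k + 1))).2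
  · rw [matApply_sub, hi, hann i hi, sub_self]

theorem antitone_objective_irls (hx : TwoSubspacesCondition x) (hQ₀ : Q 0 ∈ traceOneSymm D)
    (hQ : ∀ k, Q (k + 1) = irlsStep x (Q k)) : Antitone fun k => objective x (Q k) := by
  refine antitone_nat_of_succ_le fun k => ?_
  have h := irls_decrease hx hQ₀ hQ k
  have h0 : 0 ≤ ∑ i, 1 / ‖matApply (Q k) (x i)‖ * ‖matApply (Q k - Q (k + 1)) (x i)‖ ^ 2 :=
    Finset.sum_nonneg fun i _ => by positivity
  linarith

/-- Nonzero `‖Q_k x_i‖` are at most `F(Q_0)`, which bounds their weights below; annihilated points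
contribute no increment. -/
theorem irls_increment_sq_le (hx : TwoSubspacesCondition x) (hQ₀ : Q 0 ∈ traceOneSymm D)
    (hQ : ∀ k, Q (k + 1) = irlsStep x (Q k)) (k : ℕ) :
    ∑ i, ‖matApply (Q k - Q (k + 1)) (x i)‖ ^ 2 ≤
      2 * objective x (Q 0) * (objective x (Q k) - objective x (Q (k + 1))) := by
  have hF0 : 0 ≤ objective x (Q 0) := Finset.sum_nonneg fun i _ => norm_nonneg _
  have h : ∑ i, ‖matApply (Q k - Q (k + 1)) (x i)‖ ^ 2 ≤ objective x (Q 0) *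
      ∑ i, 1 / ‖matApply (Q k) (x i)‖ * ‖matApply (Q k - Q (k + 1)) (x i)‖ ^ 2 := by
    rw [Finset.mul_sum]
    refine Finset.sum_le_sum fun i _ => ?_
    by_cases hi : matApply (Q k) (x i) = 0
    · have hi' : matApply (Q (k + 1)) (x i) = 0 := by
        rwa [matApply_irls_eq_zero_iff hx hQ₀ hQ] at hi ⊢
      simp [matApply_sub, hi, hi']
    · have hpos : 0 < ‖matApply (Q k) (x i)‖ := norm_pos_iff.mpr hi
      have hle := (norm_matApply_le_objective x (Q k) i).trans
        (antitone_objective_irls hx hQ₀ hQ (Nat.zero_le k))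
      have : 1 ≤ objective x (Q 0) * (1 / ‖matApply (Q k) (x i)‖) := by
        rw [mul_one_div, le_div_iff₀ hpos, one_mul]
        exact hle
      rw [← mul_assoc]
      exact le_mul_of_one_le_left (sq_nonneg _) this
  have := mul_le_mul_of_nonneg_left (irls_decrease hx hQ₀ hQ k) hF0
  linarith

theorem isBounded_range_irls (hx : TwoSubspacesCondition x) (hQ₀ : Q 0 ∈ traceOneSymm D)
    (hQ : ∀ k, Q (k + 1) = irlsStep x (Q k)) : Bornology.IsBounded (Set.range Q) := by
  obtain ⟨c, hc, h⟩ := hx.exists_mul_norm_le_objective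
  refine isBounded_iff_forall_norm_le.mpr ⟨objective x (Q 0) / c, ?_⟩
  rintro _ ⟨k, rfl⟩
  rw [le_div_iff₀ hc, mul_comm]
  exact (h _).trans (antitone_objective_irls hx hQ₀ hQ (Nat.zero_le k))

theorem tendsto_dist_irls (hx : TwoSubspacesCondition x) (hQ₀ : Q 0 ∈ traceOneSymm D)
    (hQ : ∀ k, Q (k + 1) = irlsStep x (Q k)) :
    Tendsto (fun k => dist (Q (k + 1)) (Q k)) atTop (𝓝 0) := by
  obtain ⟨c, hc, h⟩ := hx.exists_mul_norm_sq_le_sum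
  have hlim := tendsto_atTop_ciInf (antitone_objective_irls hx hQ₀ hQ)
    ⟨0, by rintro _ ⟨k, rfl⟩; exact Finset.sum_nonneg fun i _ => norm_nonneg _⟩
  have hdiff : Tendsto (fun k => 2 * objective x (Q 0) / c *
      (objective x (Q k) - objective x (Q (k + 1)))) atTop (𝓝 0) := by
    simpa using (hlim.sub (hlim.comp (tendsto_add_atTop_nat 1))).const_mul
      (2 * objective x (Q 0) / c)
  have hsq : Tendsto (fun k => dist (Q (k + 1)) (Q k) ^ 2) atTop (𝓝 0) := by
    refine squeeze_zero (fun k => sq_nonneg _) (fun k => ?_) hdiff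
    rw [div_mul_eq_mul_div, le_div_iff₀ hc, dist_comm, dist_eq_norm, mul_comm]
    exact (h _).trans (irls_increment_sq_le hx hQ₀ hQ k)
  simpa using hsq.sqrt

/-- Vanishing increments give `Q_k` and `Q_{k+1}` the same limit along a subsequence, so the
first-order condition passes to the limit. -/
theorem isObjectiveStationary_of_mapClusterPt (hx : TwoSubspacesCondition x)
    (hQ₀ : Q 0 ∈ traceOneSymm D) (hQ : ∀ k, Q (k + 1) = irlsStep x (Q k))
    {A : Matrix (Fin D) (Fin D) ℝ} (hA : MapClusterPt A atTop Q) :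
    A ∈ traceOneSymm D ∧ IsObjectiveStationary x A := by
  have : FirstCountableTopology (Matrix (Fin D) (Fin D) ℝ) :=
    inferInstanceAs (FirstCountableTopology (Fin D → Fin D → ℝ))
  obtain ⟨φ, hφ, hlim⟩ := hA.tendsto_subseq
  have hlim' : Tendsto (fun n => Q (φ n + 1)) atTop (𝓝 A) := by
    refine hlim.congr_dist ?_
    have := (tendsto_dist_irls hx hQ₀ hQ).comp hφ.tendsto_atTop
    simpa [Function.comp_def, dist_comm] using this
  refine ⟨(isClosed_traceOneSymm D).mem_of_tendsto hlim
    (Eventually.of_forall fun n => irls_mem hx hQ₀ hQ _), fun Z _ hZtr hZ => ?_⟩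
  have hterm : ∀ i, Tendsto (fun n => 1 / ‖matApply (Q (φ n)) (x i)‖ *
      inner ℝ (matApply Z (x i)) (matApply (Q (φ n + 1)) (x i))) atTop
      (𝓝 (1 / ‖matApply A (x i)‖ * inner ℝ (matApply Z (x i)) (matApply A (x i)))) := by
    intro i
    -- At points annihilated only in the limit the weights blow up, but the admissible `Z`
    -- annihilate those points, so the terms are identically zero.
    by_cases hi : matApply A (x i) = 0
    · simp [hZ i hi]
    · have h1 := (((continuous_matApply (x i)).tendsto A).comp hlim).norm
      have h2 := ((continuous_matApply (x i)).tendsto A).comp hlim'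
      exact (tendsto_const_nhds.div h1 (norm_ne_zero_iff.mpr hi)).mul
        (tendsto_const_nhds.inner h2)
  refine tendsto_nhds_unique (tendsto_finsetSum _ fun i _ => hterm i)
    (tendsto_const_nhds.congr fun n => ?_)
  refine (sum_inner_irls_eq_zero hx hQ (φ n) hZtr fun i hi => hZ i ?_).symm
  have h2 := ((continuous_matApply (x i)).tendsto A).comp hlim
  refine tendsto_nhds_unique h2 (tendsto_const_nhds.congr fun m => ?_)
  change 0 = matApply (Q (φ m)) (x i)
  rw [eq_comm, matApply_irls_eq_zero_iff hx hQ₀ hQ]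
  rwa [matApply_irls_eq_zero_iff hx hQ₀ hQ] at hi

theorem exists_tendsto_irls (hx : TwoSubspacesCondition x) (hQ₀ : Q 0 ∈ traceOneSymm D)
    (hQ : ∀ k, Q (k + 1) = irlsStep x (Q k)) :
    ∃ A ∈ traceOneSymm D, IsObjectiveStationary x A ∧ Tendsto Q atTop (𝓝 A) := by
  obtain ⟨A, hA, hlim⟩ := exists_tendsto_of_finite_clusterPt (isBounded_range_irls hx hQ₀ hQ)
    (tendsto_dist_irls hx hQ₀ hQ) (hx.finite_stationary.subset fun A hA =>
      isObjectiveStationary_of_mapClusterPt hx hQ₀ hQ hA)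
  obtain ⟨h1, h2⟩ := isObjectiveStationary_of_mapClusterPt hx hQ₀ hQ hA
  exact ⟨A, h1, h2, hlim⟩

/-- The weighted quadratic model at `Q_k` has the gradient of `F` there, and its value at `Q_{k+1}`
is no larger than at `Q_k + t (A - Q_k)`. The square expanded below is the difference of these two
values. -/
theorem irls_decrease_of_direction (hx : TwoSubspacesCondition x) (hQ₀ : Q 0 ∈ traceOneSymm D)
    (hQ : ∀ k, Q (k + 1) = irlsStep x (Q k)) (k : ℕ) (hne : ∀ i, matApply (Q k) (x i) ≠ 0)
    {A : Matrix (Fin D) (Fin D) ℝ} (hA : A ∈ traceOneSymm D) {t : ℝ} (ht : 0 ≤ t) :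
    t * (objective x (Q k) - objective x A) -
        t ^ 2 / 2 * ∑ i, 1 / ‖matApply (Q k) (x i)‖ * ‖matApply (A - Q k) (x i)‖ ^ 2 ≤
      objective x (Q k) - objective x (Q (k + 1)) := by
  have hconv := objective_add_sum_inner_le x (Q k) A
  have horth := sum_inner_irls_eq_zero hx hQ k (Z := A - Q k)
    (sub_mem_tracelessSymm hA (irls_mem hx hQ₀ hQ k)).2 fun i hi => absurd hi (hne i)
  have hdec := irls_decrease hx hQ₀ hQ k
  have hsq : 0 ≤ ∑ i, 1 / ‖matApply (Q k) (x i)‖ *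
      ‖matApply (Q k - Q (k + 1)) (x i) + t • matApply (A - Q k) (x i)‖ ^ 2 :=
    Finset.sum_nonneg fun i _ => by positivity
  have hexp : ∑ i, 1 / ‖matApply (Q k) (x i)‖ *
      ‖matApply (Q k - Q (k + 1)) (x i) + t • matApply (A - Q k) (x i)‖ ^ 2 =
      ∑ i, 1 / ‖matApply (Q k) (x i)‖ * ‖matApply (Q k - Q (k + 1)) (x i)‖ ^ 2 +
      2 * t * (∑ i, 1 / ‖matApply (Q k) (x i)‖ *
        inner ℝ (matApply (A - Q k) (x i)) (matApply (Q k) (x i)) -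
        ∑ i, 1 / ‖matApply (Q k) (x i)‖ *
          inner ℝ (matApply (A - Q k) (x i)) (matApply (Q (k + 1)) (x i))) +
      t ^ 2 * ∑ i, 1 / ‖matApply (Q k) (x i)‖ * ‖matApply (A - Q k) (x i)‖ ^ 2 := by
    rw [← Finset.sum_sub_distrib, Finset.mul_sum, Finset.mul_sum, ← Finset.sum_add_distrib,
      ← Finset.sum_add_distrib]
    refine Finset.sum_congr rfl fun i _ => ?_
    rw [norm_add_sq_real, norm_smul, real_inner_smul_right, mul_pow, Real.norm_eq_abs, sq_abs,
      ← mul_sub, ← inner_sub_right, ← matApply_sub, real_inner_comm]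
    ring
  rw [horth, sub_zero] at hexp
  nlinarith [mul_le_mul_of_nonneg_left hconv ht]

theorem convergesLinearly_irls (hx : TwoSubspacesCondition x) (hQ₀ : Q 0 ∈ traceOneSymm D)
    (hQ : ∀ k, Q (k + 1) = irlsStep x (Q k)) {A : Matrix (Fin D) (Fin D) ℝ}
    (hA : A ∈ traceOneSymm D) (hs : IsObjectiveStationary x A) (hlim : Tendsto Q atTop (𝓝 A))
    (h0 : ∀ i, matApply A (x i) ≠ 0) : ConvergesLinearly Q A := by
  have hlimi : ∀ i, Tendsto (fun k => matApply (Q k) (x i)) atTop (𝓝 (matApply A (x i))) :=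
    fun i => ((continuous_matApply (x i)).tendsto A).comp hlim
  -- All iterates annihilate the same points, so a point killed once would be killed in the limit.
  have hne : ∀ k i, matApply (Q k) (x i) ≠ 0 := fun k i hi => by
    refine h0 i (tendsto_nhds_unique (hlimi i) (tendsto_const_nhds.congr fun m => ?_))
    rw [eq_comm, matApply_irls_eq_zero_iff hx hQ₀ hQ]
    rwa [matApply_irls_eq_zero_iff hx hQ₀ hQ] at hi
  obtain ⟨b, hb⟩ : ∃ b, ∀ k i, 1 / ‖matApply (Q k) (x i)‖ ≤ b := by
    obtain ⟨b, hb⟩ := (tendsto_finsetSum Finset.univ fun i _ =>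
      (tendsto_const_nhds (x := (1 : ℝ))).div (hlimi i).norm
        (norm_ne_zero_iff.mpr (h0 i))).bddAbove_range
    refine ⟨b, fun k i => le_trans ?_ (hb ⟨k, rfl⟩)⟩
    exact Finset.single_le_sum (f := fun i => 1 / ‖matApply (Q k) (x i)‖)
      (fun i _ => by positivity) (Finset.mem_univ i)
  obtain ⟨m, hm, hgrow⟩ := hx.exists_quadratic_growth hA hs h0
  obtain ⟨C, hC, hup⟩ := exists_sum_normSq_le x
  set F₀ := objective x (Q 0) with hF₀
  set e : ℕ → ℝ := fun k => objective x (Q k) - objective x A with he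
  have hF₀0 : 0 ≤ F₀ := Finset.sum_nonneg fun i _ => norm_nonneg _
  have he0 : ∀ k, 0 ≤ e k := fun k => sub_nonneg.mpr
    (hs.objective_le hA (irls_mem hx hQ₀ hQ k) fun i hi => absurd hi (h0 i))
  have hdist : ∀ k, ‖Q k - A‖ ^ 2 ≤ F₀ / m * e k := fun k => by
    rw [div_mul_eq_mul_div, le_div_iff₀ hm, mul_comm]
    exact (hgrow _ (irls_mem hx hQ₀ hQ k)).trans (mul_le_mul_of_nonneg_right
      (antitone_objective_irls hx hQ₀ hQ (Nat.zero_le k)) (he0 k))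
  obtain ⟨Λ, hΛ1, hΛ⟩ : ∃ Λ, 1 ≤ Λ ∧ ∀ k,
      ∑ i, 1 / ‖matApply (Q k) (x i)‖ * ‖matApply (A - Q k) (x i)‖ ^ 2 ≤ Λ * e k := by
    -- The maximum with `1` serves only to keep the contraction factor `1 - 1 / (2Λ)` positive.
    refine ⟨max 1 (|b| * (C * (F₀ / m))), le_max_left _ _, fun k => ?_⟩
    calc ∑ i, 1 / ‖matApply (Q k) (x i)‖ * ‖matApply (A - Q k) (x i)‖ ^ 2
        ≤ ∑ i, |b| * ‖matApply (A - Q k) (x i)‖ ^ 2 := Finset.sum_le_sum fun i _ =>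
          mul_le_mul_of_nonneg_right ((hb k i).trans (le_abs_self b)) (sq_nonneg _)
      _ = |b| * ∑ i, ‖matApply (A - Q k) (x i)‖ ^ 2 := by rw [Finset.mul_sum]
      _ ≤ |b| * (C * ‖A - Q k‖ ^ 2) := mul_le_mul_of_nonneg_left (hup _) (abs_nonneg b)
      _ ≤ |b| * (C * (F₀ / m * e k)) := by rw [norm_sub_rev]; gcongr; exact hdist k
      _ = |b| * (C * (F₀ / m)) * e k := by ring
      _ ≤ _ := mul_le_mul_of_nonneg_right (le_max_right _ _) (he0 k)
  have hΛ0 : 0 < Λ := by linarith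
  set ρ := 1 - 1 / (2 * Λ) with hρ
  have hρ1 : ρ < 1 := by
    have : 0 < 1 / (2 * Λ) := by positivity
    linarith
  have hρ0 : 0 < ρ := by
    have : 1 / (2 * Λ) ≤ 1 / 2 := one_div_le_one_div_of_le (by norm_num) (by linarith)
    linarith
  have hstep : ∀ k, e (k + 1) ≤ ρ * e k := fun k => by
    -- `t = 1 / Λ` maximizes `t e - t² Λ e / 2`, giving a guaranteed decrease of `e / (2Λ)`.
    have h := irls_decrease_of_direction hx hQ₀ hQ k (hne k) hA (t := 1 / Λ) (by positivity)
    have h2 := mul_le_mul_of_nonneg_left (hΛ k) (by positivity : 0 ≤ (1 / Λ) ^ 2 / 2)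
    have h3 : (1 / Λ) ^ 2 / 2 * (Λ * e k) = 1 / (2 * Λ) * e k := by field_simp
    have h4 : 1 / Λ * e k = 2 * (1 / (2 * Λ) * e k) := by field_simp
    have h5 : objective x (Q k) - objective x (Q (k + 1)) = e k - e (k + 1) := by
      simp only [he]; ring
    rw [h5] at h
    change 1 / Λ * e k - _ ≤ _ at h
    rw [hρ, sub_mul, one_mul]
    linarith
  have hgeo : ∀ k, e k ≤ ρ ^ k * e 0 := fun k => by
    induction k with
    | zero => simp
    | succ k ih =>
      rw [pow_succ', mul_assoc]
      exact (hstep k).trans (mul_le_mul_of_nonneg_left ih hρ0.le)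
  -- The rate is `√ρ` because the gap in `F` controls the squared distance; the `+ 1` keeps the
  -- constant positive when the initial gap is zero.
  refine ⟨D * √(F₀ / m * e 0) + 1, √ρ, by positivity, Real.sqrt_pos.mpr hρ0,
    (Real.sqrt_lt' one_pos).mpr (by simpa using hρ1), fun k => ?_⟩
  have hnorm : ‖Q k - A‖ ≤ √(F₀ / m * e 0) * √ρ ^ k := by
    refine le_of_sq_le_sq ?_ (by positivity)
    have := he0 0
    rw [mul_pow, Real.sq_sqrt (by positivity), ← pow_mul, mul_comm k 2, pow_mul,
      Real.sq_sqrt hρ0.le]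
    calc _ ≤ F₀ / m * e k := hdist k
      _ ≤ F₀ / m * (ρ ^ k * e 0) := by gcongr; exact hgeo k
      _ = _ := by ring
  calc frobNorm (Q k - A) ≤ D * ‖Q k - A‖ := frobNorm_le _
    _ ≤ D * (√(F₀ / m * e 0) * √ρ ^ k) := by gcongr
    _ ≤ (D * √(F₀ / m * e 0) + 1) * √ρ ^ k := by
      have : 0 ≤ √ρ ^ k := by positivity
      nlinarith

end Sequence

theorem mainTheorem3 (D N : ℕ) (x : Fin N → EuclideanSpace ℝ (Fin D))
    (hx : TwoSubspacesCondition x)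
    (Q : ℕ → Matrix (Fin D) (Fin D) ℝ)
    (hQ₀ : Q 0 ∈ traceOneSymm D)
    (hQ : ∀ k, Q (k + 1) = irlsStep x (Q k)) :
    ∃ Qhat : Matrix (Fin D) (Fin D) ℝ,
      (IsObjectiveMinimizer x Qhat ∧ ∀ Q', IsObjectiveMinimizer x Q' → Q' = Qhat) ∧
      ∃ Qtilde ∈ traceOneSymm D,
        Filter.Tendsto Q Filter.atTop (𝓝 Qtilde) ∧
        ((∀ i, matApply Qtilde (x i) ≠ 0) →
          ConvergesLinearly Q Qtilde ∧ Qtilde = Qhat) := by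
  obtain ⟨Qhat, hhat⟩ := hx.exists_isObjectiveMinimizer ⟨Q 0, hQ₀⟩
  obtain ⟨A, hA, hs, hlim⟩ := exists_tendsto_irls hx hQ₀ hQ
  refine ⟨Qhat, ⟨hhat, fun Q' hQ' => hx.isObjectiveMinimizer_unique hQ' hhat⟩, A, hA, hlim,
    fun h0 => ⟨convergesLinearly_irls hx hQ₀ hQ hA hs hlim h0, ?_⟩⟩
  exact hx.isObjectiveMinimizer_unique
    ⟨hA, fun B hB => hs.objective_le hA hB fun i hi => absurd hi (h0 i)⟩ hhat
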